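/- Let $\mathbb{H}$ be the quaternions with the Euclidean norm $|\cdot|$ and inner product, $\mathbb{S}=\{I\in\mathbb{H}:\operatorname{Re} I=0,\ |I|=1\}$ the sphere of imaginary units, $L_I=\mathbb{R}+\mathbb{R}I$ the slice of $I\in\mathbb{S}$, $\mathbb{B}=\{q:|q|<1\}$ and $\mathbb{H}^+=\{q:\operatorname{Re} q>0\}$. Let $g$ be the Riemannian metric on $\mathbb{B}$ given as follows: for $w\in\mathbb{B}$ lying in the slice $L_{I_w}$ and $d\in T_w\mathbb{B}\cong\mathbb{H}$, written as $d=d_1+d_2$ with $d_1\in L_{I_w}$, $d_2\in L_{I_w}^{\perp}$, $$|d|_{g(w)}^2=\frac{|d_1|^2}{(1-|w|^2)^2}+\frac{|d_2|^2}{|1-w^2|^2}.$$ Let $C:\mathbb{B}\to\mathbb{H}^+$, $C(q)=(1-q)^{-1}(1+q)$, be the Cayley map, with inverse $C^{-1}(u)=(1+u)^{-1}(u-1)$, and let $h$ be the image of $g$ on $\mathbb{H}^+$, i.e. $|v|_{h(u)}=\big|(C^{-1})_*[u](v)\big|_{g(C^{-1}(u))}$, where $(C^{-1})_*[u]$ is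 the real differential. Let $d_h$ be the Riemannian distance of $h$ on $\mathbb{H}^+$ (the infimum of the $h$-lengths of $C^1$ curves in $\mathbb{H}^+$ joining two points). For $I_0\in\mathbb{S}$ let $\pi_{I_0}(x+yI)=x+yI_0$ for $x\in\mathbb{R}$, $y\ge 0$, $I\in\mathbb{S}$; let $d_{hyp}$ be the Riemannian distance on the half-plane $\{x+yI_0: x>0,\ y\in\mathbb{R}\}$ of the metric $(dx^2+dy^2)/(4x^2)$; and let $d_{\mathbb{S}}$ be the usual spherical distance on $\mathbb{S}$, i.e. the Riemannian distance of the metric induced on $\mathbb{S}$ by the Euclidean one. **Theorem.** There are absolute constants $C_1,C_2>0$ such that for every $I_0\in\mathbb{S}$ and all points $q_j=x_j+y_jI_j\in\mathbb{H}^+$, $j=1,2$, with $x_j>0$, $y_j\ge 0$, $I_j\in\mathbb{S}$, the distance $d_h(q_1,q_2)$ is finite and $$C_1\,d_h(q_1,q_2)\ \le\ d_{hyp}\big(\pi_{I_0}(q_1),\pi_{I_0}(q_2)\big)+\min\Big\{\frac{y_1}{|q_1|},\frac{y_2}{|q_2|}\Big\}\,d_{\mathbb{S}}(I_1,I_2)\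 \le\ C_2\,d_h(q_1,q_2).$$ -/

import Mathlib

open MeasureTheory Set
open scoped Quaternion ENNReal

namespace SliceMetric

noncomputable section

/-- The Riemannian (extended) distance on a subset `U` of a real normed space (here always an open
subset or an embedded submanifold) for the metric tensor `ds² = Q`, where `Q p v` is the squared
length of the tangent vector `v` at the point `p`: the infimum of the lengths
`∫₀¹ √(Q (γ t) (γ' t)) dt` over all `C¹` curves `γ : [0,1] → U` going from `p` to `q`.
It is `⊤` if there is no such curve. -/
def riemEDist {E : Type*} [NormedAddCommGroup E] [NormedSpace ℝ E]
    (U : Set E) (Q : E → E → ℝ) (p q : E) : ℝ≥0∞ :=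
  ⨅ (γ : ℝ → E) (_ : ContDiffOn ℝ 1 γ (Icc 0 1)) (_ : MapsTo γ (Icc 0 1) U)
    (_ : γ 0 = p) (_ : γ 1 = q),
    ∫⁻ t in Icc (0 : ℝ) 1, ENNReal.ofReal (√(Q (γ t) (derivWithin γ (Icc 0 1) t)))

/-- The sphere `𝕊` of imaginary units. -/
def imSphere : Set ℍ[ℝ] := {I | I.re = 0 ∧ ‖I‖ = 1}

/-- The slice `L_I = ℝ + ℝ I`, as a real subspace of the quaternions. -/
def slice (I : ℍ[ℝ]) : Submodule ℝ ℍ[ℝ] := Submodule.span ℝ {1, I}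

open Classical in
/-- An imaginary unit `I_w` such that `w` lies in the slice of `I_w`: the normalized imaginary part
of `w` if `w` is not real, and the unit `i` (an arbitrary choice) if `w` is real. -/
def imUnit (w : ℍ[ℝ]) : ℍ[ℝ] := if w.im = 0 then ⟨0, 1, 0, 0⟩ else ‖w.im‖⁻¹ • w.im

/-- The metric tensor `g` on the unit ball: if `d = d₁ + d₂` with `d₁` in the slice `L` of `w` and
`d₂` orthogonal to `L`, then `|d|²_{g(w)} = |d₁|² / (1 - |w|²)² + |d₂|² / |1 - w²|²`.
(For real `w` the two coefficients agree, so that the choice of the slice does not matter.) -/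
def gTensor (w d : ℍ[ℝ]) : ℝ :=
  1 / (1 - ‖w‖ ^ 2) ^ 2 * ‖(slice (imUnit w)).starProjection d‖ ^ 2
    + 1 / ‖1 - w ^ 2‖ ^ 2 * ‖(slice (imUnit w))ᗮ.starProjection d‖ ^ 2

/-- The right half-space `ℍ⁺`. -/
def halfSpace : Set ℍ[ℝ] := {q | 0 < q.re}

/-- The Cayley map `C`, from the unit ball onto the right half-space. -/
def cayley (q : ℍ[ℝ]) : ℍ[ℝ] := (1 - q)⁻¹ * (1 + q)

/-- The inverse `C⁻¹` of the Cayley map, from the right half-space onto the unit ball. -/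
def cayleyInv (u : ℍ[ℝ]) : ℍ[ℝ] := (1 + u)⁻¹ * (u - 1)

theorem norm_cayleyInv_lt_one {u : ℍ[ℝ]} (hu : u ∈ halfSpace) : ‖cayleyInv u‖ < 1 := by
  have hu' : 0 < u.re := hu
  have h1 : ‖u - 1‖ ^ 2 < ‖1 + u‖ ^ 2 := by
    simp only [← Quaternion.normSq_eq_norm_mul_self, sq, Quaternion.normSq_def']
    simp
    nlinarith
  have h2 : ‖u - 1‖ < ‖1 + u‖ := lt_of_pow_lt_pow_left₀ 2 (norm_nonneg _) h1
  have h3 : 0 < ‖1 + u‖ := lt_of_le_of_lt (norm_nonneg _) h2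
  rw [cayleyInv, norm_mul, norm_inv, inv_mul_lt_iff₀ h3, mul_one]
  exact h2

theorem one_add_ne_zero {u : ℍ[ℝ]} (hu : u ∈ halfSpace) : 1 + u ≠ 0 := by
  intro h
  have h1 := congrArg (fun q : ℍ[ℝ] => q.re) h
  have hu' : 0 < u.re := hu
  simp at h1
  linarith

theorem one_sub_ne_zero {q : ℍ[ℝ]} (hq : ‖q‖ < 1) : 1 - q ≠ 0 := by
  intro h
  rw [← sub_eq_zero.mp h] at hq
  simp at hq

theorem cayley_cayleyInv {u : ℍ[ℝ]} (hu : u ∈ halfSpace) : cayley (cayleyInv u) = u := by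
  have h0 := one_add_ne_zero hu
  have h1 := one_sub_ne_zero (norm_cayleyInv_lt_one hu)
  have e : (1 + u) * cayleyInv u = u - 1 := by rw [cayleyInv, mul_inv_cancel_left₀ h0]
  have c : u * cayleyInv u = cayleyInv u * u := by
    have h2 : Commute u (1 + u) := (Commute.one_right u).add_right (Commute.refl u)
    have h3 : Commute u (u - 1) := (Commute.refl u).sub_right (Commute.one_right u)
    exact (h2.inv_right₀.mul_right h3)
  rw [cayley, inv_mul_eq_iff_eq_mul₀ h1]
  rw [add_mul, one_mul, c] at e
  rw [sub_mul, one_mul, eq_sub_iff_add_eq, add_assoc, e]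
  abel

theorem cayley_mem_halfSpace {q : ℍ[ℝ]} (hq : ‖q‖ < 1) : cayley q ∈ halfSpace := by
  have h0 := one_sub_ne_zero hq
  have hq2 : ‖q‖ ^ 2 < 1 := by nlinarith [norm_nonneg q]
  have hn : 0 < Quaternion.normSq (1 - q) :=
    lt_of_le_of_ne Quaternion.normSq_nonneg (Ne.symm (by simpa using h0))
  simp only [sq, ← Quaternion.normSq_eq_norm_mul_self, Quaternion.normSq_def'] at hq2
  change 0 < ((1 - q)⁻¹ * (1 + q)).re
  rw [Quaternion.inv_def, smul_mul_assoc, Quaternion.re_smul, smul_eq_mul]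
  apply mul_pos (inv_pos.mpr hn)
  simp
  nlinarith

theorem cayleyInv_cayley {q : ℍ[ℝ]} (hq : ‖q‖ < 1) : cayleyInv (cayley q) = q := by
  have h0 := one_sub_ne_zero hq
  have h1 := one_add_ne_zero (cayley_mem_halfSpace hq)
  have e : (1 - q) * cayley q = 1 + q := by rw [cayley, mul_inv_cancel_left₀ h0]
  have c : q * cayley q = cayley q * q := by
    have h2 : Commute q (1 - q) := (Commute.one_right q).sub_right (Commute.refl q)
    have h3 : Commute q (1 + q) := (Commute.one_right q).add_right (Commute.refl q)
    exact (h2.inv_right₀.mul_right h3)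
  rw [cayleyInv, inv_mul_eq_iff_eq_mul₀ h1]
  rw [sub_mul, one_mul, c, sub_eq_iff_eq_add] at e
  rw [add_mul, one_mul, sub_eq_iff_eq_add]
  exact e.trans (by abel)

/-- The metric tensor `h` on the right half-space, the image of `g` under the Cayley map, that is
the pullback of `g` by `C⁻¹`: `|v|_{h(u)} = |(C⁻¹)_*[u] v|_{g(C⁻¹ u)}`, with `(C⁻¹)_*[u]` the real
differential. -/
def hTensor (u v : ℍ[ℝ]) : ℝ := gTensor (cayleyInv u) (fderiv ℝ cayleyInv u v)

/-- The distance `d_h` on the right half-space. -/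
def distH (p q : ℍ[ℝ]) : ℝ≥0∞ := riemEDist halfSpace hTensor p q

/-- The hyperbolic distance on the half-plane `ℍ⁺ ∩ L_I = {x + y I : x > 0}`, associated with
the metric tensor `(dx² + dy²) / (4 x²)`. -/
def distHyp (I p q : ℍ[ℝ]) : ℝ≥0∞ :=
  riemEDist (halfSpace ∩ slice I) (fun u v => ‖v‖ ^ 2 / (4 * u.re ^ 2)) p q

/-- The spherical distance on `𝕊`, associated with the metric induced by the Euclidean one. -/
def distSphere (I J : ℍ[ℝ]) : ℝ≥0∞ := riemEDist imSphere (fun _ v => ‖v‖ ^ 2) I J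

/-- The projection `x + y I ↦ x + y I₀` (`y ≥ 0`, `I ∈ 𝕊`) onto the slice of `I₀`. -/
def sliceProj (I₀ q : ℍ[ℝ]) : ℍ[ℝ] := (q.re : ℍ[ℝ]) + ‖q.im‖ • I₀

end

end SliceMetric

/-! In the half-space the metric becomes explicit: if v₁ is the part of v in the slice of u and v₂
the part orthogonal to it, then |v|²_h = |v₁|²/(4 (Re u)²) + |v₂|²/(4|u|²) (`hTensor_eq`). So h is
hyperbolic along each slice, while turning the imaginary unit of x + yI costs y/(2|q|) times the
angle.

Upper bound for d_h: turn the unit at whichever endpoint has the smaller ratio y/|q|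
(`distH_le_distSphere`), and cover the rest inside one slice, at hyperbolic cost
(`distH_le_distHyp`).

Lower bound, hyperbolic term: forgetting the unit does not increase speeds, because v₁ already
accounts for the motion of (x, y). The map is not smooth where y = 0, so y is replaced by √(y² + ε²)
and ε is sent to 0 (`distHyp_sliceProj_le`).

Lower bound, spherical term: since Re u ≤ |u|, h dominates |v|²/(4|u|²), and the radial projection q
↦ q/|q| decreases |v|/|u|. Hence the chord between q₁/|q₁| and q₂/|q₂| is at most 2 d_h. That chord
is at least min(y₁/|q₁|, y₂/|q₂|) |I₁ - I₂|, and |I₁ - I₂| is comparable to the angle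
(`min_mul_distSphere_le`). -/

namespace SliceMetric

/-! ### Lengths of C¹ curves, Lipschitz maps and the triangle inequality -/

section RiemannianDistance

variable {E F : Type*} [NormedAddCommGroup E] [NormedSpace ℝ E]
  [NormedAddCommGroup F] [NormedSpace ℝ F]

theorem riemEDist_le_lintegral {U : Set E} {Q : E → E → ℝ} {p q : E} {γ : ℝ → E}
    (hγ : ContDiffOn ℝ 1 γ (Icc 0 1)) (hU : MapsTo γ (Icc 0 1) U) (h0 : γ 0 = p) (h1 : γ 1 = q) :
    riemEDist U Q p q ≤
      ∫⁻ t in Icc (0 : ℝ) 1, ENNReal.ofReal (√(Q (γ t) (derivWithin γ (Icc 0 1) t))) :=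
  iInf_le_of_le γ <| iInf_le_of_le hγ <| iInf_le_of_le hU <| iInf_le_of_le h0 <|
    iInf_le_of_le h1 le_rfl

theorem le_riemEDist {U : Set E} {Q : E → E → ℝ} {p q : E} {a : ℝ≥0∞}
    (h : ∀ γ : ℝ → E, ContDiffOn ℝ 1 γ (Icc 0 1) → MapsTo γ (Icc 0 1) U → γ 0 = p → γ 1 = q →
      a ≤ ∫⁻ t in Icc (0 : ℝ) 1, ENNReal.ofReal (√(Q (γ t) (derivWithin γ (Icc 0 1) t)))) :
    a ≤ riemEDist U Q p q :=
  le_iInf fun γ => le_iInf fun hγ => le_iInf fun hU => le_iInf fun h0 => le_iInf fun h1 =>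
    h γ hγ hU h0 h1

theorem hasDerivWithinAt_of_contDiffOn {γ : ℝ → E} (hγ : ContDiffOn ℝ 1 γ (Icc 0 1)) {t : ℝ}
    (ht : t ∈ Icc (0 : ℝ) 1) :
    HasDerivWithinAt γ (derivWithin γ (Icc 0 1) t) (Icc 0 1) t :=
  ((hγ.differentiableOn one_ne_zero) t ht).hasDerivWithinAt

theorem uniqueDiffWithinAt_unitInterval {t : ℝ} (ht : t ∈ Icc (0 : ℝ) 1) :
    UniqueDiffWithinAt ℝ (Icc (0 : ℝ) 1) t :=
  uniqueDiffOn_Icc zero_lt_one t ht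

/-- A speed bound along a curve bounds the Riemannian distance of its endpoints. -/
theorem riemEDist_le_ofReal {U : Set E} {Q : E → E → ℝ} {γ γ' : ℝ → E} {M : ℝ}
    (hγ : ContDiffOn ℝ 1 γ (Icc 0 1)) (hU : MapsTo γ (Icc 0 1) U)
    (hγ' : ∀ t ∈ Icc (0 : ℝ) 1, HasDerivWithinAt γ (γ' t) (Icc 0 1) t)
    (hM : ∀ t ∈ Icc (0 : ℝ) 1, √(Q (γ t) (γ' t)) ≤ M) :
    riemEDist U Q (γ 0) (γ 1) ≤ ENNReal.ofReal M := by
  refine (riemEDist_le_lintegral hγ hU rfl rfl).trans ?_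
  calc _ ≤ ∫⁻ _ in Icc (0 : ℝ) 1, ENNReal.ofReal M := by
        refine setLIntegral_mono' measurableSet_Icc fun t ht => ENNReal.ofReal_le_ofReal ?_
        rw [(hγ' t ht).derivWithin (uniqueDiffWithinAt_unitInterval ht)]
        exact hM t ht
    _ = ENNReal.ofReal M := by simp

theorem riemEDist_self {U : Set E} {Q : E → E → ℝ} {p : E} (hp : p ∈ U) (hQ : Q p 0 = 0) :
    riemEDist U Q p p = 0 := by
  have := riemEDist_le_ofReal (U := U) (Q := Q) (γ := fun _ => p) (γ' := fun _ => 0) (M := 0)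
    contDiffOn_const (fun _ _ => hp) (fun t _ => hasDerivWithinAt_const t _ p)
    (fun t _ => by simp [hQ])
  simpa using this

/-- If a map multiplies the speed of curves by at most `c`, it multiplies the distance of points
by at most `c`. -/
theorem riemEDist_map_le {U : Set E} {Q : E → E → ℝ} {V : Set F} {R : F → F → ℝ} {f : E → F}
    {c : ℝ} (hc : 0 < c) (hf : ∀ p ∈ U, ContDiffAt ℝ 1 f p) (hV : MapsTo f U V)
    (h : ∀ γ : ℝ → E, ContDiffOn ℝ 1 γ (Icc 0 1) → MapsTo γ (Icc 0 1) U → ∀ t ∈ Icc (0 : ℝ) 1,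
      √(R (f (γ t)) (fderiv ℝ f (γ t) (derivWithin γ (Icc 0 1) t))) ≤
        c * √(Q (γ t) (derivWithin γ (Icc 0 1) t))) (p q : E) :
    riemEDist V R (f p) (f q) ≤ ENNReal.ofReal c * riemEDist U Q p q := by
  have hc0 : ENNReal.ofReal c ≠ 0 := by simpa using hc
  rw [← ENNReal.inv_mul_le_iff hc0 ENNReal.ofReal_ne_top]
  refine le_riemEDist fun γ hγ hU h0 h1 => ?_
  rw [ENNReal.inv_mul_le_iff hc0 ENNReal.ofReal_ne_top,
    ← lintegral_const_mul' _ _ ENNReal.ofReal_ne_top]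
  have hfγ : ContDiffOn ℝ 1 (fun t => f (γ t)) (Icc 0 1) := fun t ht =>
    (hf _ (hU ht)).comp_contDiffWithinAt t (hγ t ht)
  refine (riemEDist_le_lintegral hfγ (hV.comp hU) (by rw [h0]) (by rw [h1])).trans ?_
  refine setLIntegral_mono' measurableSet_Icc fun t ht => ?_
  rw [← ENNReal.ofReal_mul hc.le]
  refine ENNReal.ofReal_le_ofReal ?_
  have hd : HasDerivWithinAt (fun t => f (γ t))
      (fderiv ℝ f (γ t) (derivWithin γ (Icc 0 1) t)) (Icc 0 1) t :=
    ((hf _ (hU ht)).differentiableAt one_ne_zero).hasFDerivAt.comp_hasDerivWithinAt t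
      (hasDerivWithinAt_of_contDiffOn hγ ht)
  rw [hd.derivWithin (uniqueDiffWithinAt_unitInterval ht)]
  exact h γ hγ hU t ht

theorem smoothTransition_mem_Icc (t : ℝ) : Real.smoothTransition t ∈ Icc (0 : ℝ) 1 :=
  ⟨Real.smoothTransition.nonneg t, Real.smoothTransition.le_one t⟩

/-- The length of a monotone `C¹` reparametrization of a piece of a curve is at most the length of
the curve. -/
theorem lintegral_reparam_le {Q : E → E → ℝ} (hQ : ∀ p (c : ℝ) v, Q p (c • v) = c ^ 2 * Q p v)
    {γ : ℝ → E} {ψ ψ' : ℝ → ℝ} {s : Set ℝ} (hs : MeasurableSet s)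
    (hψ : ∀ t, HasDerivAt ψ (ψ' t) t) (hmono : Monotone ψ) (hmem : ∀ t, ψ t ∈ Icc (0 : ℝ) 1) :
    ∫⁻ t in s, ENNReal.ofReal (√(Q (γ (ψ t)) (ψ' t • derivWithin γ (Icc 0 1) (ψ t)))) ≤
      ∫⁻ t in Icc (0 : ℝ) 1, ENNReal.ofReal (√(Q (γ t) (derivWithin γ (Icc 0 1) t))) := by
  have hpos : ∀ t, 0 ≤ ψ' t := fun t => by
    rw [← (hψ t).deriv]; exact hmono.deriv_nonneg
  calc _ = ∫⁻ t in s, ENNReal.ofReal (ψ' t) *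
        ENNReal.ofReal (√(Q (γ (ψ t)) (derivWithin γ (Icc 0 1) (ψ t)))) := by
        refine lintegral_congr fun t => ?_
        rw [hQ, Real.sqrt_mul (sq_nonneg _), Real.sqrt_sq (hpos t), ENNReal.ofReal_mul (hpos t)]
    _ = ∫⁻ t in ψ '' s, ENNReal.ofReal (√(Q (γ t) (derivWithin γ (Icc 0 1) t))) :=
        (lintegral_image_eq_lintegral_deriv_mul_of_monotoneOn hs
          (fun t _ => (hψ t).hasDerivWithinAt) (hmono.monotoneOn s)
          (fun t => ENNReal.ofReal (√(Q (γ t) (derivWithin γ (Icc 0 1) t))))).symm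
    _ ≤ _ := lintegral_mono_set (by rintro _ ⟨t, _, rfl⟩; exact hmem t)

/-- Concatenating C¹ curves may create a corner. Each curve is therefore reparametrized by a smooth
monotone step that comes to rest at the junction, which does not increase its length. -/
theorem riemEDist_triangle {U : Set E} {Q : E → E → ℝ}
    (hQ : ∀ p (c : ℝ) v, Q p (c • v) = c ^ 2 * Q p v) (p q r : E) :
    riemEDist U Q p r ≤ riemEDist U Q p q + riemEDist U Q q r := by
  conv_rhs => unfold riemEDist
  simp only [ENNReal.iInf_add, ENNReal.add_iInf, le_iInf_iff]
  intro γ₂ hγ₂ hU₂ h₂0 h₂1 γ₁ hγ₁ hU₁ h₁0 h₁1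
  set ψ₁ : ℝ → ℝ := fun t => Real.smoothTransition (2 * t) with hψ₁
  set ψ₂ : ℝ → ℝ := fun t => Real.smoothTransition (2 * t - 1) with hψ₂
  have c₁ : ContDiff ℝ 1 ψ₁ := Real.smoothTransition.contDiff.comp (by fun_prop)
  have c₂ : ContDiff ℝ 1 ψ₂ := Real.smoothTransition.contDiff.comp (by fun_prop)
  have m₁ : Monotone ψ₁ := fun a b hab => Real.smoothTransition.monotone (by linarith)
  have m₂ : Monotone ψ₂ := fun a b hab => Real.smoothTransition.monotone (by linarith)
  have i₁ : ∀ t, ψ₁ t ∈ Icc (0 : ℝ) 1 := fun t => smoothTransition_mem_Icc _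
  have i₂ : ∀ t, ψ₂ t ∈ Icc (0 : ℝ) 1 := fun t => smoothTransition_mem_Icc _
  have d₁ : ∀ t, HasDerivAt ψ₁ (deriv ψ₁ t) t := fun t =>
    (c₁.differentiable one_ne_zero t).hasDerivAt
  have d₂ : ∀ t, HasDerivAt ψ₂ (deriv ψ₂ t) t := fun t =>
    (c₂.differentiable one_ne_zero t).hasDerivAt
  have e₁ : ∀ t, 1 / 2 ≤ t → ψ₁ t = 1 := fun t ht =>
    Real.smoothTransition.one_of_one_le (by linarith)
  have e₂ : ∀ t, t ≤ 1 / 2 → ψ₂ t = 0 := fun t ht =>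
    Real.smoothTransition.zero_of_nonpos (by linarith)
  -- There ψ₁ attains its maximum 1, so its derivative vanishes, also at the junction t = 1/2. The
  -- same holds for ψ₂ at its minimum 0.
  have z₁ : ∀ t, 1 / 2 ≤ t → deriv ψ₁ t = 0 := fun t ht =>
    IsLocalMax.deriv_eq_zero (Filter.Eventually.of_forall fun s => by rw [e₁ t ht]; exact (i₁ s).2)
  have z₂ : ∀ t, t ≤ 1 / 2 → deriv ψ₂ t = 0 := fun t ht =>
    IsLocalMin.deriv_eq_zero (Filter.Eventually.of_forall fun s => by rw [e₂ t ht]; exact (i₂ s).1)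
  have key : ∀ {γ : ℝ → E} {ψ : ℝ → ℝ}, ContDiffOn ℝ 1 γ (Icc 0 1) → (∀ t, ψ t ∈ Icc (0 : ℝ) 1) →
      (∀ t, HasDerivAt ψ (deriv ψ t) t) → ∀ t,
      HasDerivAt (fun t => γ (ψ t)) (deriv ψ t • derivWithin γ (Icc 0 1) (ψ t)) t := by
    intro γ ψ hγ hi hd t
    have := (hasDerivWithinAt_of_contDiffOn hγ (hi t)).scomp t ((hd t).hasDerivWithinAt (s := univ))
      (fun s _ => hi s)
    exact hasDerivWithinAt_univ.mp this
  -- On each half one of the two summands rests at q, so this is the concatenation, written as a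
  -- single formula whose smoothness needs no case split.
  set γ : ℝ → E := fun t => γ₁ (ψ₁ t) + γ₂ (ψ₂ t) - q with hγdef
  have hγd : ∀ t, HasDerivAt γ (deriv ψ₁ t • derivWithin γ₁ (Icc 0 1) (ψ₁ t) +
      deriv ψ₂ t • derivWithin γ₂ (Icc 0 1) (ψ₂ t)) t := fun t =>
    ((key hγ₁ i₁ d₁ t).add (key hγ₂ i₂ d₂ t)).sub_const q
  have l : ∀ t, t ≤ 1 / 2 → γ t = γ₁ (ψ₁ t) := fun t ht => by simp [hγdef, e₂ t ht, h₂0]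
  have u : ∀ t, 1 / 2 ≤ t → γ t = γ₂ (ψ₂ t) := fun t ht => by simp [hγdef, e₁ t ht, h₁1]
  have hγ : ContDiff ℝ 1 γ :=
    ((contDiffOn_univ.mp (hγ₁.comp c₁.contDiffOn fun t _ => i₁ t)).add
      (contDiffOn_univ.mp (hγ₂.comp c₂.contDiffOn fun t _ => i₂ t))).sub contDiff_const
  have hU : MapsTo γ (Icc 0 1) U := by
    intro t _
    rcases le_total t (1 / 2) with h | h
    · rw [l t h]; exact hU₁ (i₁ t)
    · rw [u t h]; exact hU₂ (i₂ t)
  have h0 : γ 0 = p := by rw [l 0 (by norm_num)]; simp [hψ₁, h₁0]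
  have h1 : γ 1 = r := by
    rw [u 1 (by norm_num), hψ₂]; norm_num [h₂1]
  refine (riemEDist_le_lintegral hγ.contDiffOn hU h0 h1).trans ?_
  have hsplit : ∀ f : ℝ → ℝ≥0∞, ∫⁻ t in Icc (0 : ℝ) 1, f t ≤
      (∫⁻ t in Icc (0 : ℝ) (1 / 2), f t) + ∫⁻ t in Icc (1 / 2 : ℝ) 1, f t := fun f => by
    rw [← Icc_union_Icc_eq_Icc (show (0 : ℝ) ≤ 1 / 2 by norm_num) (by norm_num)]
    exact lintegral_union_le _ _ _
  refine (hsplit _).trans (add_le_add ?_ ?_)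
  · refine le_trans (le_of_eq ?_) (lintegral_reparam_le (γ := γ₁) (s := Icc 0 (1 / 2)) hQ
      measurableSet_Icc d₁ m₁ i₁)
    refine setLIntegral_congr_fun measurableSet_Icc fun t ht => ?_
    rw [(hγd t).hasDerivWithinAt.derivWithin
      (uniqueDiffWithinAt_unitInterval ⟨ht.1, by linarith [ht.2]⟩), l t ht.2, z₂ t ht.2, zero_smul,
      add_zero]
  · refine le_trans (le_of_eq ?_) (lintegral_reparam_le (γ := γ₂) (s := Icc (1 / 2) 1) hQ
      measurableSet_Icc d₂ m₂ i₂)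
    refine setLIntegral_congr_fun measurableSet_Icc fun t ht => ?_
    rw [(hγd t).hasDerivWithinAt.derivWithin
      (uniqueDiffWithinAt_unitInterval ⟨by linarith [ht.1], ht.2⟩), u t ht.1, z₁ t ht.1, zero_smul,
      zero_add]

end RiemannianDistance

/-! ### Slices of the quaternions and the explicit form of h -/

section Tensor

theorem quaternion_re_mul_comm (a b : ℍ[ℝ]) : (a * b).re = (b * a).re := by
  simp only [Quaternion.re_mul]; ring

theorem quaternion_inner_eq (a b : ℍ[ℝ]) :
    inner ℝ a b = a.re * b.re + a.imI * b.imI + a.imJ * b.imJ + a.imK * b.imK := by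
  simp only [Quaternion.inner_def, Quaternion.re_mul, Quaternion.re_star, Quaternion.imI_star,
    Quaternion.imJ_star, Quaternion.imK_star]
  ring

theorem quaternion_norm_sq (a : ℍ[ℝ]) :
    ‖a‖ ^ 2 = a.re ^ 2 + a.imI ^ 2 + a.imJ ^ 2 + a.imK ^ 2 := by
  rw [← real_inner_self_eq_norm_sq, quaternion_inner_eq]; ring

theorem sum_sq_of_mem_imSphere {I : ℍ[ℝ]} (hI : I ∈ imSphere) :
    I.imI ^ 2 + I.imJ ^ 2 + I.imK ^ 2 = 1 := by
  have := quaternion_norm_sq I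
  rw [hI.2, hI.1] at this
  linarith

theorem mem_slice_iff {I z : ℍ[ℝ]} : z ∈ slice I ↔ ∃ a b : ℝ, z = (a : ℍ[ℝ]) + b • I := by
  rw [slice, Submodule.mem_span_pair]
  refine exists_congr fun a => exists_congr fun b => ?_
  rw [eq_comm, ← Quaternion.coe_mul_eq_smul a, mul_one]

theorem coe_add_smul_mem_slice (I : ℍ[ℝ]) (a b : ℝ) : (a : ℍ[ℝ]) + b • I ∈ slice I :=
  mem_slice_iff.mpr ⟨a, b, rfl⟩

theorem mul_mem_slice {I z w : ℍ[ℝ]} (hI : I ∈ imSphere) (hz : z ∈ slice I) (hw : w ∈ slice I) :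
    z * w ∈ slice I := by
  obtain ⟨a, b, rfl⟩ := mem_slice_iff.mp hz
  obtain ⟨c, d, rfl⟩ := mem_slice_iff.mp hw
  refine mem_slice_iff.mpr ⟨a * c - b * d, a * d + b * c, ?_⟩
  have h := sum_sq_of_mem_imSphere hI
  have h0 := hI.1
  ext <;> simp [h0]
  · linear_combination (-(b * d)) * h
  all_goals ring

theorem star_mem_slice {I z : ℍ[ℝ]} (hI : I ∈ imSphere) (hz : z ∈ slice I) : star z ∈ slice I := by
  obtain ⟨a, b, rfl⟩ := mem_slice_iff.mp hz
  refine mem_slice_iff.mpr ⟨a, -b, ?_⟩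
  have h0 := hI.1
  ext <;> simp [h0]

theorem inv_mem_slice {I z : ℍ[ℝ]} (hI : I ∈ imSphere) (hz : z ∈ slice I) : z⁻¹ ∈ slice I := by
  rw [Quaternion.inv_def]
  exact Submodule.smul_mem _ _ (star_mem_slice hI hz)

theorem inner_coe_add_smul {I : ℍ[ℝ]} (v : ℍ[ℝ]) (a b : ℝ) :
    inner ℝ v ((a : ℍ[ℝ]) + b • I) = v.re * a + b * inner ℝ v I := by
  simp only [quaternion_inner_eq]
  simp
  ring

/-- The orthogonal projection onto a slice in terms of real part and inner product. -/
theorem slice_starProjection {I : ℍ[ℝ]} (hI : I ∈ imSphere) (v : ℍ[ℝ]) :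
    (slice I).starProjection v = (v.re : ℍ[ℝ]) + (inner ℝ v I : ℝ) • I := by
  refine Submodule.eq_starProjection_of_mem_of_inner_eq_zero (coe_add_smul_mem_slice _ _ _)
    fun w hw => ?_
  obtain ⟨a, b, rfl⟩ := mem_slice_iff.mp hw
  rw [inner_coe_add_smul, inner_sub_left]
  have h := sum_sq_of_mem_imSphere hI
  have h0 := hI.1
  simp only [quaternion_inner_eq]
  simp only [Quaternion.re_sub, Quaternion.re_add, Quaternion.re_coe, Quaternion.re_smul, Quaternion.imI_add,
    Quaternion.imI_coe, Quaternion.imI_smul, Quaternion.imJ_add, Quaternion.imJ_coe,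
    Quaternion.imJ_smul, Quaternion.imK_add, Quaternion.imK_coe, Quaternion.imK_smul, h0,
    smul_eq_mul]
  linear_combination (-b * (v.imI * I.imI + v.imJ * I.imJ + v.imK * I.imK)) * h

theorem norm_sq_coe_add_smul {I : ℍ[ℝ]} (hI : I ∈ imSphere) (a b : ℝ) :
    ‖(a : ℍ[ℝ]) + b • I‖ ^ 2 = a ^ 2 + b ^ 2 := by
  have h := sum_sq_of_mem_imSphere hI
  have h0 := hI.1
  rw [quaternion_norm_sq]
  simp [h0]
  linear_combination b ^ 2 * h

theorem norm_sq_slice_starProjection {I : ℍ[ℝ]} (hI : I ∈ imSphere) (v : ℍ[ℝ]) :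
    ‖(slice I).starProjection v‖ ^ 2 = v.re ^ 2 + (inner ℝ v I : ℝ) ^ 2 := by
  rw [slice_starProjection hI, norm_sq_coe_add_smul hI]

theorem imUnit_of_im_eq_zero {u : ℍ[ℝ]} (h : u.im = 0) : imUnit u = ⟨0, 1, 0, 0⟩ := if_pos h

theorem imUnit_of_im_ne_zero {u : ℍ[ℝ]} (h : u.im ≠ 0) : imUnit u = ‖u.im‖⁻¹ • u.im := if_neg h

theorem imUnit_mem_imSphere (u : ℍ[ℝ]) : imUnit u ∈ imSphere := by
  by_cases h : u.im = 0
  · rw [imUnit_of_im_eq_zero h]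
    refine ⟨rfl, (sq_eq_sq₀ (norm_nonneg _) zero_le_one).mp ?_⟩
    refine (quaternion_norm_sq _).trans ?_
    norm_num
  · rw [imUnit_of_im_ne_zero h]
    refine ⟨by simp, ?_⟩
    rw [norm_smul, norm_inv, norm_norm, inv_mul_cancel₀ (norm_ne_zero_iff.mpr h)]

theorem coe_re_add_norm_im_smul_imUnit (u : ℍ[ℝ]) : (u.re : ℍ[ℝ]) + ‖u.im‖ • imUnit u = u := by
  by_cases h : u.im = 0
  · conv_rhs => rw [← Quaternion.re_add_im u, h]
    rw [h, norm_zero, zero_smul]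
  · rw [imUnit_of_im_ne_zero h, smul_smul, mul_inv_cancel₀ (norm_ne_zero_iff.mpr h), one_smul,
      Quaternion.re_add_im]

theorem mem_slice_imUnit (u : ℍ[ℝ]) : u ∈ slice (imUnit u) :=
  mem_slice_iff.mpr ⟨_, _, (coe_re_add_norm_im_smul_imUnit u).symm⟩

theorem imUnit_eq_of_im_eq_smul {u w : ℍ[ℝ]} {c : ℝ} (hc : 0 < c) (h : w.im = c • u.im) :
    imUnit w = imUnit u := by
  by_cases hu : u.im = 0
  · rw [imUnit_of_im_eq_zero hu, imUnit_of_im_eq_zero (by rw [h, hu, smul_zero])]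
  · have hw : w.im ≠ 0 := by rw [h]; exact smul_ne_zero hc.ne' hu
    rw [imUnit_of_im_ne_zero hu, imUnit_of_im_ne_zero hw, h, norm_smul, Real.norm_of_nonneg hc.le,
      smul_smul]
    congr 1
    field_simp

theorem im_of_mem_imSphere {I : ℍ[ℝ]} (hI : I ∈ imSphere) : I.im = I := by
  have h0 := hI.1
  ext <;> simp [h0]

theorem im_coe_add_smul {I : ℍ[ℝ]} (hI : I ∈ imSphere) (x y : ℝ) :
    ((x : ℍ[ℝ]) + y • I).im = y • I := by
  have h0 := hI.1
  ext <;> simp [h0]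

theorem imUnit_coe_add_smul {I : ℍ[ℝ]} (hI : I ∈ imSphere) (x : ℝ) {y : ℝ} (hy : 0 < y) :
    imUnit ((x : ℍ[ℝ]) + y • I) = I := by
  have hI0 : I ≠ 0 := by rintro rfl; simpa using hI.2
  rw [imUnit_eq_of_im_eq_smul (u := I) hy (by rw [im_coe_add_smul hI, im_of_mem_imSphere hI]),
    imUnit_of_im_ne_zero (by rwa [im_of_mem_imSphere hI]), im_of_mem_imSphere hI, hI.2, inv_one,
    one_smul]

theorem gTensor_eq {w I : ℍ[ℝ]} (h : imUnit w = I) (d : ℍ[ℝ]) :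
    gTensor w d = 1 / (1 - ‖w‖ ^ 2) ^ 2 * ‖(slice I).starProjection d‖ ^ 2
      + 1 / ‖1 - w ^ 2‖ ^ 2 * ‖(slice I)ᗮ.starProjection d‖ ^ 2 := by
  subst h; rfl

/-- With u occurring only once, the noncommutative differential reduces to that of inversion. -/
theorem cayleyInv_eq {u : ℍ[ℝ]} (hu : u ∈ halfSpace) : cayleyInv u = 1 - (2 : ℝ) • (1 + u)⁻¹ := by
  have h0 := one_add_ne_zero hu
  have : u - 1 = (1 + u) - (2 : ℝ) • 1 := by rw [two_smul]; abel
  rw [cayleyInv, this, mul_sub, inv_mul_cancel₀ h0, mul_smul_comm, mul_one]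

theorem fderiv_cayleyInv {u : ℍ[ℝ]} (hu : u ∈ halfSpace) (v : ℍ[ℝ]) :
    fderiv ℝ cayleyInv u v = (2 : ℝ) • ((1 + u)⁻¹ * v * (1 + u)⁻¹) := by
  have h0 := one_add_ne_zero hu
  have hev : cayleyInv =ᶠ[nhds u] fun u => 1 - (2 : ℝ) • (1 + u)⁻¹ := by
    have : IsOpen halfSpace := isOpen_lt continuous_const Quaternion.continuous_re
    filter_upwards [this.mem_nhds hu] with w hw using cayleyInv_eq hw
  have h1 : HasFDerivAt (fun u : ℍ[ℝ] => 1 + u) (ContinuousLinearMap.id ℝ ℍ[ℝ]) u :=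
    (hasFDerivAt_id u).const_add 1
  have h2 := (((hasFDerivAt_inv' (𝕜 := ℝ) h0).comp u h1).const_smul (2 : ℝ)).const_sub 1
  rw [hev.fderiv_eq]
  have h3 : HasFDerivAt (fun u : ℍ[ℝ] => 1 - (2 : ℝ) • (1 + u)⁻¹) _ u := h2
  rw [h3.fderiv]
  simp

theorem one_sub_norm_cayleyInv_sq {u : ℍ[ℝ]} (hu : u ∈ halfSpace) :
    1 - ‖cayleyInv u‖ ^ 2 = 4 * u.re / ‖1 + u‖ ^ 2 := by
  have h0 : ‖1 + u‖ ≠ 0 := norm_ne_zero_iff.mpr (one_add_ne_zero hu)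
  have h : ‖1 + u‖ ^ 2 - ‖u - 1‖ ^ 2 = 4 * u.re := by
    simp only [quaternion_norm_sq]; simp; ring
  rw [cayleyInv, norm_mul, norm_inv, ← h]
  field_simp

theorem norm_one_sub_cayleyInv_sq {u : ℍ[ℝ]} (hu : u ∈ halfSpace) :
    ‖1 - cayleyInv u ^ 2‖ = 4 * ‖u‖ / ‖1 + u‖ ^ 2 := by
  have h0 := one_add_ne_zero hu
  have h1 : (1 + u)⁻¹ * u = 1 - (1 + u)⁻¹ := by
    have h : u = (1 + u) - 1 := by abel
    conv_lhs => rw [h, mul_sub, ← h, inv_mul_cancel₀ h0, mul_one]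
  -- With a = (1 + u)⁻¹ one has C⁻¹(u) = 1 - 2a and au = 1 - a, so both sides equal 4a(1 - a).
  have h2 : 1 - cayleyInv u ^ 2 = (4 : ℝ) • ((1 + u)⁻¹ * ((1 + u)⁻¹ * u)) := by
    rw [h1, cayleyInv_eq hu, show (4 : ℝ) = 2 * 2 by norm_num, mul_smul]
    simp only [two_smul]
    noncomm_ring
  rw [h2, norm_smul, norm_mul, norm_mul, norm_inv]
  have : ‖1 + u‖ ≠ 0 := norm_ne_zero_iff.mpr h0
  norm_num
  field_simp

/-- The imaginary part of C⁻¹(u) is 2/|1 + u|² times that of u; the positive factor excludes the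
opposite unit. -/
theorem imUnit_cayleyInv {u : ℍ[ℝ]} (hu : u ∈ halfSpace) : imUnit (cayleyInv u) = imUnit u := by
  have hn : 0 < Quaternion.normSq (1 + u) :=
    lt_of_le_of_ne Quaternion.normSq_nonneg (Ne.symm (by simpa using one_add_ne_zero hu))
  refine imUnit_eq_of_im_eq_smul (c := 2 * (Quaternion.normSq (1 + u))⁻¹) (by positivity) ?_
  rw [cayleyInv_eq hu, Quaternion.inv_def]
  ext <;> simp [mul_assoc]

/-- The map v ↦ m v m and its adjoint w ↦ m̄ w m̄ both preserve the slice, so it also preserves the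
orthogonal complement. Applied with m = (1 + u)⁻¹, this makes the differential of C⁻¹ respect the
splitting. -/
theorem slice_starProjection_mul_mul {I m : ℍ[ℝ]} (hI : I ∈ imSphere) (hm : m ∈ slice I)
    (v : ℍ[ℝ]) :
    (slice I).starProjection (m * v * m) = m * (slice I).starProjection v * m := by
  refine Submodule.eq_starProjection_of_mem_of_inner_eq_zero
    (mul_mem_slice hI (mul_mem_slice hI hm (Submodule.starProjection_apply_mem _ _)) hm)
    fun w hw => ?_
  rw [← mul_sub_right_distrib, ← mul_sub]
  have hw' : star m * w * star m ∈ slice I :=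
    mul_mem_slice hI (mul_mem_slice hI (star_mem_slice hI hm) hw) (star_mem_slice hI hm)
  rw [← Submodule.starProjection_inner_eq_zero v _ hw', Quaternion.inner_def, Quaternion.inner_def]
  simp only [star_mul, star_star]
  rw [mul_assoc m, mul_assoc m, quaternion_re_mul_comm m]
  simp only [mul_assoc]

/-- The metric tensor on the half-space: `|v|²_{h(u)} = |v₁|² / (4 (Re u)²) + |v₂|² / (4 |u|²)`. -/
theorem hTensor_eq {u : ℍ[ℝ]} (hu : u ∈ halfSpace) (v : ℍ[ℝ]) :
    hTensor u v = ‖(slice (imUnit u)).starProjection v‖ ^ 2 / (4 * u.re ^ 2) +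
      (‖v‖ ^ 2 - ‖(slice (imUnit u)).starProjection v‖ ^ 2) / (4 * ‖u‖ ^ 2) := by
  have hI := imUnit_mem_imSphere u
  have hre : 0 < u.re := hu
  have hu0 : 0 < ‖u‖ := norm_pos_iff.mpr (by rintro rfl; simp at hre)
  have hN : 0 < ‖1 + u‖ := norm_pos_iff.mpr (one_add_ne_zero hu)
  have hm : (1 + u)⁻¹ ∈ slice (imUnit u) :=
    inv_mem_slice hI (Submodule.add_mem _ (Submodule.subset_span (by simp)) (mem_slice_imUnit u))
  have h1 := Submodule.norm_sq_eq_add_norm_sq_starProjection (fderiv ℝ cayleyInv u v)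
    (slice (imUnit u))
  rw [hTensor, gTensor_eq (imUnit_cayleyInv hu), one_sub_norm_cayleyInv_sq hu,
    norm_one_sub_cayleyInv_sq hu, eq_sub_iff_add_eq'.mpr h1.symm, fderiv_cayleyInv hu, map_smul,
    slice_starProjection_mul_mul hI hm]
  simp only [norm_smul, norm_mul, norm_inv, Real.norm_ofNat]
  field_simp
  ring

theorem hTensor_smul (u : ℍ[ℝ]) (c : ℝ) (v : ℍ[ℝ]) : hTensor u (c • v) = c ^ 2 * hTensor u v := by
  simp only [hTensor, gTensor, map_smul, norm_smul, mul_pow, Real.norm_eq_abs, sq_abs]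
  ring

theorem re_sq_le_norm_sq (u : ℍ[ℝ]) : u.re ^ 2 ≤ ‖u‖ ^ 2 := by
  rw [quaternion_norm_sq]; nlinarith [sq_nonneg u.imI, sq_nonneg u.imJ, sq_nonneg u.imK]

theorem hTensor_le {u : ℍ[ℝ]} (hu : u ∈ halfSpace) (v : ℍ[ℝ]) :
    hTensor u v ≤ ‖v‖ ^ 2 / (4 * u.re ^ 2) := by
  have hre : 0 < u.re := hu
  have h1 := Submodule.norm_sq_eq_add_norm_sq_starProjection v (slice (imUnit u))
  have h2 : (‖v‖ ^ 2 - ‖(slice (imUnit u)).starProjection v‖ ^ 2) / (4 * ‖u‖ ^ 2) ≤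
      (‖v‖ ^ 2 - ‖(slice (imUnit u)).starProjection v‖ ^ 2) / (4 * u.re ^ 2) := by
    refine div_le_div_of_nonneg_left ?_ (by positivity)
      (mul_le_mul_of_nonneg_left (re_sq_le_norm_sq u) (by norm_num))
    · nlinarith [sq_nonneg ‖(slice (imUnit u))ᗮ.starProjection v‖]
  rw [hTensor_eq hu]
  calc _ ≤ _ := add_le_add_right h2 _
    _ = _ := by ring

theorem le_hTensor {u : ℍ[ℝ]} (hu : u ∈ halfSpace) (v : ℍ[ℝ]) :
    ‖v‖ ^ 2 / (4 * ‖u‖ ^ 2) ≤ hTensor u v := by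
  have hre : 0 < u.re := hu
  have h2 : ‖(slice (imUnit u)).starProjection v‖ ^ 2 / (4 * ‖u‖ ^ 2) ≤
      ‖(slice (imUnit u)).starProjection v‖ ^ 2 / (4 * u.re ^ 2) := by
    exact div_le_div_of_nonneg_left (sq_nonneg _) (by positivity)
      (mul_le_mul_of_nonneg_left (re_sq_le_norm_sq u) (by norm_num))
  rw [hTensor_eq hu]
  calc _ = _ + _ := by ring
    _ ≤ _ := add_le_add_left h2 _

/-- Only the slice component is kept; it is what the projection onto a fixed slice sees. -/
theorem starProjection_le_hTensor {u : ℍ[ℝ]} (hu : u ∈ halfSpace) (v : ℍ[ℝ]) :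
    (v.re ^ 2 + (inner ℝ v (imUnit u) : ℝ) ^ 2) / (4 * u.re ^ 2) ≤ hTensor u v := by
  have h1 := Submodule.norm_sq_eq_add_norm_sq_starProjection v (slice (imUnit u))
  rw [hTensor_eq hu, norm_sq_slice_starProjection (imUnit_mem_imSphere u)] at *
  refine le_add_of_nonneg_right (div_nonneg ?_ (by positivity))
  nlinarith [sq_nonneg ‖(slice (imUnit u))ᗮ.starProjection v‖]

theorem hTensor_of_orthogonal {u : ℍ[ℝ]} (hu : u ∈ halfSpace) {v : ℍ[ℝ]} (hv : v.re = 0)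
    (hv' : inner ℝ v (imUnit u) = (0 : ℝ)) : hTensor u v = ‖v‖ ^ 2 / (4 * ‖u‖ ^ 2) := by
  rw [hTensor_eq hu, norm_sq_slice_starProjection (imUnit_mem_imSphere u), hv, hv']
  simp

end Tensor

/-! ### Moving inside a slice, rotating the unit, and the angular lower bound -/

section Comparison

theorem re_coe_add_smul {I : ℍ[ℝ]} (hI : I ∈ imSphere) (x y : ℝ) :
    ((x : ℍ[ℝ]) + y • I).re = x := by
  simp [hI.1]

theorem inner_coe_add_smul_self {I : ℍ[ℝ]} (hI : I ∈ imSphere) (x y : ℝ) :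
    inner ℝ ((x : ℍ[ℝ]) + y • I) I = y := by
  have h := sum_sq_of_mem_imSphere hI
  rw [real_inner_comm]
  have := inner_coe_add_smul (I := I) I x y
  rw [this, hI.1, real_inner_self_eq_norm_sq, hI.2]
  ring

theorem norm_coe_add_smul {I : ℍ[ℝ]} (hI : I ∈ imSphere) (x y : ℝ) :
    ‖(x : ℍ[ℝ]) + y • I‖ = √(x ^ 2 + y ^ 2) := by
  rw [← norm_sq_coe_add_smul hI, Real.sqrt_sq (norm_nonneg _)]

theorem quaternion_inner_one_left (v : ℍ[ℝ]) : inner ℝ 1 v = v.re := by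
  rw [quaternion_inner_eq]; simp

theorem coe_add_smul_mem_halfSpace {I : ℍ[ℝ]} (hI : I ∈ imSphere) {x : ℝ} (hx : 0 < x) (y : ℝ) :
    (x : ℍ[ℝ]) + y • I ∈ halfSpace := by
  change 0 < ((x : ℍ[ℝ]) + y • I).re
  rwa [re_coe_add_smul hI]

/-- The real linear map `x + y I₀ ↦ x + y I`, extended by `0` orthogonally to the slice of `I₀`. -/
noncomputable def sliceMap (I₀ I : ℍ[ℝ]) : ℍ[ℝ] →L[ℝ] ℍ[ℝ] :=
  (innerSL ℝ (1 : ℍ[ℝ])).smulRight 1 + (innerSL ℝ I₀).smulRight I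

theorem sliceMap_apply (I₀ I v : ℍ[ℝ]) :
    sliceMap I₀ I v = (v.re : ℍ[ℝ]) + (inner ℝ v I₀ : ℝ) • I := by
  simp only [sliceMap, add_apply, ContinuousLinearMap.smulRight_apply,
    innerSL_apply_apply, quaternion_inner_one_left]
  rw [← Quaternion.coe_mul_eq_smul v.re, mul_one, real_inner_comm]

theorem norm_sliceMap_le {I₀ I : ℍ[ℝ]} (hI₀ : I₀ ∈ imSphere) (hI : I ∈ imSphere) (v : ℍ[ℝ]) :
    ‖sliceMap I₀ I v‖ ≤ ‖v‖ := by
  refine le_of_eq_of_le ?_ (Submodule.norm_starProjection_apply_le (slice I₀) v)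
  rw [slice_starProjection hI₀, sliceMap_apply, norm_coe_add_smul hI, norm_coe_add_smul hI₀]

theorem distH_le_distHyp {I₀ I : ℍ[ℝ]} (hI₀ : I₀ ∈ imSphere) (hI : I ∈ imSphere)
    (x₁ y₁ x₂ y₂ : ℝ) :
    distH ((x₁ : ℍ[ℝ]) + y₁ • I) ((x₂ : ℍ[ℝ]) + y₂ • I) ≤
      distHyp I₀ ((x₁ : ℍ[ℝ]) + y₁ • I₀) ((x₂ : ℍ[ℝ]) + y₂ • I₀) := by
  have hre : ∀ p, (sliceMap I₀ I p).re = p.re := fun p => by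
    rw [sliceMap_apply, re_coe_add_smul hI]
  have hV : MapsTo (sliceMap I₀ I) (halfSpace ∩ slice I₀) halfSpace := fun p hp => by
    change 0 < (sliceMap I₀ I p).re
    rw [hre]
    exact hp.1
  have hmap : ∀ x y : ℝ, sliceMap I₀ I ((x : ℍ[ℝ]) + y • I₀) = (x : ℍ[ℝ]) + y • I := fun x y => by
    rw [sliceMap_apply, re_coe_add_smul hI₀, inner_coe_add_smul_self hI₀]
  have := riemEDist_map_le (Q := fun u v => ‖v‖ ^ 2 / (4 * u.re ^ 2)) (R := hTensor) one_pos
    (fun p _ => (sliceMap I₀ I).contDiff.contDiffAt) hV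
    (fun γ _ hγU t ht => by
      rw [one_mul, ContinuousLinearMap.fderiv]
      refine Real.sqrt_le_sqrt ((hTensor_le (hV (hγU ht)) _).trans ?_)
      rw [hre]
      gcongr
      exact norm_sliceMap_le hI₀ hI _)
    ((x₁ : ℍ[ℝ]) + y₁ • I₀) ((x₂ : ℍ[ℝ]) + y₂ • I₀)
  rwa [hmap, hmap, ENNReal.ofReal_one, one_mul] at this

theorem hTensor_zero (u : ℍ[ℝ]) : hTensor u 0 = 0 := by simp [hTensor, gTensor]

/-- Curves in the sphere of imaginary units have velocities which are imaginary and orthogonal to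
their position. -/
theorem derivWithin_of_mapsTo_imSphere {γ : ℝ → ℍ[ℝ]} (hγ : ContDiffOn ℝ 1 γ (Icc 0 1))
    (hU : MapsTo γ (Icc 0 1) imSphere) {t : ℝ} (ht : t ∈ Icc (0 : ℝ) 1) :
    (derivWithin γ (Icc 0 1) t).re = 0 ∧ inner ℝ (derivWithin γ (Icc 0 1) t) (γ t) = (0 : ℝ) := by
  have hd := hasDerivWithinAt_of_contDiffOn hγ ht
  have hu := uniqueDiffWithinAt_unitInterval ht
  constructor
  · have h1 := (innerSL ℝ (1 : ℍ[ℝ])).hasFDerivAt.comp_hasDerivWithinAt t hd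
    have h2 : HasDerivWithinAt ((innerSL ℝ (1 : ℍ[ℝ])) ∘ γ) 0 (Icc 0 1) t :=
      (hasDerivWithinAt_const t _ (0 : ℝ)).congr_of_mem
        (fun s hs => by simpa [quaternion_inner_one_left] using (hU hs).1) ht
    have := hu.eq_deriv _ h1 h2
    rwa [innerSL_apply_apply, quaternion_inner_one_left] at this
  · have h1 := hd.norm_sq
    have h2 : HasDerivWithinAt (fun s => ‖γ s‖ ^ 2) 0 (Icc 0 1) t :=
      (hasDerivWithinAt_const t _ (1 : ℝ)).congr_of_mem
        (fun s hs => by simp [(hU hs).2]) ht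
    have := hu.eq_deriv _ h1 h2
    rw [real_inner_comm]
    linarith

/-- Rotating the imaginary unit of a point. -/
theorem distH_le_distSphere (I J : ℍ[ℝ]) {x y : ℝ}
    (hx : 0 < x) (hy : 0 ≤ y) :
    distH ((x : ℍ[ℝ]) + y • I) ((x : ℍ[ℝ]) + y • J) ≤
      ENNReal.ofReal (y / √(x ^ 2 + y ^ 2)) * distSphere I J := by
  -- For y = 0 both points coincide. This case is separate because `riemEDist_map_le` needs a
  -- positive factor and `imUnit` takes an arbitrary value at real points.
  rcases hy.eq_or_lt with rfl | hy
  · simp only [zero_smul, zero_div, ENNReal.ofReal_zero, zero_mul, add_zero, nonpos_iff_eq_zero]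
    exact riemEDist_self (by simpa [halfSpace] using hx) (hTensor_zero _)
  have hV : MapsTo (fun p : ℍ[ℝ] => (x : ℍ[ℝ]) + y • p) imSphere halfSpace := fun p hp =>
    coe_add_smul_mem_halfSpace hp hx y
  have hd : ∀ p : ℍ[ℝ], HasFDerivAt (fun p : ℍ[ℝ] => (x : ℍ[ℝ]) + y • p)
      (y • ContinuousLinearMap.id ℝ ℍ[ℝ]) p := fun p =>
    ((hasFDerivAt_id p).const_smul y).const_add _
  refine riemEDist_map_le (Q := fun _ v => ‖v‖ ^ 2) (R := hTensor) (by positivity)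
    (fun p _ => by fun_prop) hV (fun γ hγ hU t ht => ?_) I J
  obtain ⟨h1, h2⟩ := derivWithin_of_mapsTo_imSphere hγ hU ht
  rw [(hd _).fderiv]
  simp only [smul_apply, ContinuousLinearMap.id_apply]
  rw [hTensor_of_orthogonal (hV (hU ht)) (by simp [h1])
    (by rw [imUnit_coe_add_smul (hU ht) x hy, inner_smul_left, h2, mul_zero]),
    norm_coe_add_smul (hU ht), Real.sqrt_sq (norm_nonneg _), norm_smul, Real.norm_of_nonneg hy.le]
  -- The speed is exactly half of the claimed bound; the factor 1/2 is dropped.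
  refine Real.sqrt_le_iff.mpr ⟨by positivity, ?_⟩
  rw [mul_pow, mul_pow, div_pow, div_mul_eq_mul_div]
  gcongr
  nlinarith [sq_nonneg √(x ^ 2 + y ^ 2)]

/-- Turn the (i, j) components by a right angle; if they vanish, I is a multiple of k and the
default unit i is orthogonal to it. -/
theorem exists_mem_imSphere_inner_eq_zero (I : ℍ[ℝ]) (hI : I.re = 0) :
    ∃ K ∈ imSphere, inner ℝ I K = (0 : ℝ) := by
  obtain ⟨z, hz0, hz1, hz2, hz3⟩ : ∃ z : ℍ[ℝ], z.re = 0 ∧ z.imI = I.imJ ∧ z.imJ = -I.imI ∧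
      z.imK = 0 := ⟨⟨0, I.imJ, -I.imI, 0⟩, rfl, rfl, rfl, rfl⟩
  refine ⟨imUnit z, imUnit_mem_imSphere z, ?_⟩
  by_cases h : z.im = 0
  · have h1 : I.imI = 0 := by
      have := congrArg (fun q : ℍ[ℝ] => q.imJ) h
      simpa [hz2] using this
    rw [imUnit_of_im_eq_zero h]
    refine (quaternion_inner_eq _ _).trans ?_
    simp [h1]
  · rw [imUnit_of_im_ne_zero h, inner_smul_right, quaternion_inner_eq]
    simp only [Quaternion.re_im, Quaternion.imI_im, Quaternion.imJ_im, Quaternion.imK_im, hz1, hz2,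
      hz3, hI]
    ring

/-- The great circle arc has length θ = arccos⟨I, J⟩ and its chord is 2 sin(θ/2); Jordan's
inequality on [0, π/2] gives θ ≤ (π/2)·chord. -/
theorem distSphere_le {I J : ℍ[ℝ]} (hI : I ∈ imSphere) (hJ : J ∈ imSphere) :
    distSphere I J ≤ ENNReal.ofReal (Real.pi / 2 * ‖I - J‖) := by
  set c : ℝ := inner ℝ I J with hc
  have hcabs : |c| ≤ 1 := by simpa [hI.2, hJ.2] using abs_real_inner_le_norm I J
  obtain ⟨hc1, hc2⟩ := abs_le.mp hcabs
  set θ := Real.arccos c with hθ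
  have hcos : Real.cos θ = c := Real.cos_arccos hc1 hc2
  have hθ0 : 0 ≤ θ := Real.arccos_nonneg c
  have hθπ : θ ≤ Real.pi := Real.arccos_le_pi c
  have hII : inner ℝ I I = (1 : ℝ) := by rw [real_inner_self_eq_norm_sq, hI.2, one_pow]
  have hJJ : inner ℝ J J = (1 : ℝ) := by rw [real_inner_self_eq_norm_sq, hJ.2, one_pow]
  have hJI : inner ℝ J I = c := real_inner_comm _ _
  set w := J - c • I with hw
  have hIw : inner ℝ I w = (0 : ℝ) := by
    rw [hw, inner_sub_right, inner_smul_right, hII, ← hc]; ring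
  have hwn : ‖w‖ = Real.sin θ := by
    rw [← sq_eq_sq₀ (norm_nonneg _) (Real.sin_nonneg_of_nonneg_of_le_pi hθ0 hθπ), Real.sin_sq, hcos,
      ← real_inner_self_eq_norm_sq]
    conv_lhs => rw [hw]
    simp only [inner_sub_left, inner_sub_right, inner_smul_left, inner_smul_right, hII, hJJ, hJI,
      ← hc, RCLike.conj_to_real]
    ring
  -- K is the initial direction of the arc. If J = ±I then w = 0, and any unit orthogonal to I
  -- serves.
  obtain ⟨K, hK, hIK, hKw⟩ : ∃ K ∈ imSphere, inner ℝ I K = (0 : ℝ) ∧ ‖w‖ • K = w := by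
    by_cases h : w = 0
    · obtain ⟨K, hK, hIK⟩ := exists_mem_imSphere_inner_eq_zero I hI.1
      exact ⟨K, hK, hIK, by simp [h]⟩
    · have hn : ‖w‖ ≠ 0 := norm_ne_zero_iff.mpr h
      refine ⟨‖w‖⁻¹ • w, ⟨?_, ?_⟩, ?_, ?_⟩
      · simp [hw, hI.1, hJ.1]
      · rw [norm_smul, norm_inv, norm_norm, inv_mul_cancel₀ hn]
      · rw [inner_smul_right, hIw, mul_zero]
      · rw [smul_smul, mul_inv_cancel₀ hn, one_smul]
  have hKI : inner ℝ K I = (0 : ℝ) := by rw [real_inner_comm, hIK]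
  have hKK : inner ℝ K K = (1 : ℝ) := by rw [real_inner_self_eq_norm_sq, hK.2, one_pow]
  have hnorm : ∀ a b : ℝ, ‖a • I + b • K‖ ^ 2 = a ^ 2 + b ^ 2 := fun a b => by
    rw [← real_inner_self_eq_norm_sq]
    simp only [inner_add_left, inner_add_right, inner_smul_left, inner_smul_right, hII, hKK, hKI,
      hIK, RCLike.conj_to_real]
    ring
  have hJ' : J = Real.cos θ • I + Real.sin θ • K := by
    rw [← hwn, hKw, hcos, hw]; abel
  set γ : ℝ → ℍ[ℝ] := fun t => Real.cos (t * θ) • I + Real.sin (t * θ) • K with hγ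
  have hγd : ∀ t, HasDerivAt γ ((-Real.sin (t * θ) * θ) • I + (Real.cos (t * θ) * θ) • K) t := by
    intro t
    have h1 : HasDerivAt (fun t : ℝ => t * θ) θ t := by simpa using (hasDerivAt_id t).mul_const θ
    exact (h1.cos.smul_const I).add (h1.sin.smul_const K)
  have hmain : distSphere (γ 0) (γ 1) ≤ ENNReal.ofReal θ := by
    refine riemEDist_le_ofReal (ContDiff.contDiffOn (by fun_prop)) (fun t _ => ⟨?_, ?_⟩)
      (fun t _ => (hγd t).hasDerivWithinAt) (fun t _ => ?_)
    · simp [hγ, hI.1, hK.1]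
    · refine (sq_eq_sq₀ (norm_nonneg _) zero_le_one).mp ?_
      rw [hnorm, Real.cos_sq_add_sin_sq, one_pow]
    · rw [hnorm]
      refine Real.sqrt_le_iff.mpr ⟨hθ0, le_of_eq ?_⟩
      linear_combination θ ^ 2 * Real.sin_sq_add_cos_sq (t * θ)
  have h0 : γ 0 = I := by simp [hγ]
  have h1 : γ 1 = J := by simp only [hγ, one_mul, ← hJ']
  rw [h0, h1] at hmain
  refine hmain.trans (ENNReal.ofReal_le_ofReal ?_)
  have hIJ : ‖I - J‖ = 2 * Real.sin (θ / 2) := by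
    have hs : 0 ≤ Real.sin (θ / 2) :=
      Real.sin_nonneg_of_nonneg_of_le_pi (by linarith) (by linarith)
    rw [← sq_eq_sq₀ (norm_nonneg _) (by positivity), norm_sub_sq_real, hI.2, hJ.2, ← hc, ← hcos,
      mul_pow, Real.sin_sq_eq_half_sub]
    rw [mul_div_cancel₀ θ two_ne_zero]
    ring
  have h2 := Real.mul_le_sin (x := θ / 2) (by linarith) (by linarith)
  rw [hIJ]
  calc θ = Real.pi / 2 * (2 * (2 / Real.pi * (θ / 2))) := by
        field_simp
    _ ≤ _ := by gcongr

/-- The radial projection onto the unit sphere does not increase lengths measured by `|v| / |p|`. -/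
theorem norm_fderiv_normalize_le {E : Type*} [NormedAddCommGroup E] [InnerProductSpace ℝ E] {p : E}
    (hp : p ≠ 0) (v : E) : ‖fderiv ℝ (fun q : E => ‖q‖⁻¹ • q) p v‖ ≤ ‖v‖ / ‖p‖ := by
  have hn : 0 < ‖p‖ := norm_pos_iff.mpr hp
  have h1 : HasFDerivAt (fun q : E => √(‖q‖ ^ 2)) _ p :=
    (hasStrictFDerivAt_norm_sq p).hasFDerivAt.sqrt (by positivity)
  have h2 : HasFDerivAt (fun q : E => (√(‖q‖ ^ 2))⁻¹ • q) _ p :=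
    ((hasDerivAt_inv (by positivity)).comp_hasFDerivAt p h1).smul (hasFDerivAt_id p)
  simp only [Real.sqrt_sq (norm_nonneg _)] at h2
  have h3 : fderiv ℝ (fun q : E => ‖q‖⁻¹ • q) p v =
      ‖p‖⁻¹ • v - (inner ℝ p v / ‖p‖ ^ 3) • p := by
    rw [h2.fderiv]
    simp
    rw [← sub_eq_add_neg]
    congr 2
    field_simp
  rw [h3, ← sq_le_sq₀ (norm_nonneg _) (by positivity), norm_sub_sq_real]
  simp only [norm_smul, inner_smul_left, inner_smul_right, real_inner_comm p v]
  simp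
  field_simp
  nlinarith [sq_abs (inner ℝ p v), sq_nonneg (inner ℝ p v)]

theorem contDiffAt_normalize {E : Type*} [NormedAddCommGroup E] [InnerProductSpace ℝ E] {p : E}
    (hp : p ≠ 0) : ContDiffAt ℝ 1 (fun q : E => ‖q‖⁻¹ • q) p :=
  ((contDiffAt_norm ℝ hp).inv (norm_ne_zero_iff.mpr hp)).smul contDiffAt_id

theorem enorm_sub_le_riemEDist {E : Type*} [NormedAddCommGroup E] [NormedSpace ℝ E]
    [CompleteSpace E] (U : Set E) (p q : E) :
    ‖q - p‖ₑ ≤ riemEDist U (fun _ v => ‖v‖ ^ 2) p q := by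
  refine le_riemEDist fun γ hγ _ h0 h1 => ?_
  rw [← h0, ← h1]
  refine (enorm_sub_le_lintegral_derivWithin_Icc_of_contDiffOn_Icc hγ zero_le_one).trans_eq ?_
  simp [Real.sqrt_sq (norm_nonneg _)]

theorem ne_zero_of_mem_halfSpace {u : ℍ[ℝ]} (hu : u ∈ halfSpace) : u ≠ 0 := by
  rintro rfl
  exact lt_irrefl (0 : ℝ) hu

/-- The factor 2 compensates for the speed |v|/(2|u|) supplied by `le_hTensor`. -/
theorem normalize_sub_le_distH (p q : ℍ[ℝ]) :
    ENNReal.ofReal ‖‖p‖⁻¹ • p - ‖q‖⁻¹ • q‖ ≤ ENNReal.ofReal 2 * distH p q := by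
  have := riemEDist_map_le (U := halfSpace) (V := univ) (Q := hTensor) (R := fun _ v => ‖v‖ ^ 2)
    two_pos (fun u hu => contDiffAt_normalize (ne_zero_of_mem_halfSpace hu)) (mapsTo_univ _ _)
    (fun γ _ hU t ht => by
      rw [Real.sqrt_sq (norm_nonneg _)]
      refine (norm_fderiv_normalize_le (ne_zero_of_mem_halfSpace (hU ht)) _).trans ?_
      have h1 := Real.sqrt_le_sqrt (le_hTensor (hU ht) (derivWithin γ (Icc 0 1) t))
      rw [show 4 * ‖γ t‖ ^ 2 = (2 * ‖γ t‖) ^ 2 by ring, ← div_pow, Real.sqrt_sq (by positivity)] at h1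
      calc _ = 2 * (‖derivWithin γ (Icc 0 1) t‖ / (2 * ‖γ t‖)) := by ring
        _ ≤ _ := by gcongr) p q
  rw [norm_sub_rev, ofReal_norm]
  exact (enorm_sub_le_riemEDist _ _ _).trans this

/-- By the law of cosines the squared distance is (a - b)² + (s - t)² + st|I - J|², and min(s, t)² ≤
st. -/
theorem min_mul_norm_sub_le {I J : ℍ[ℝ]} (hI : I ∈ imSphere) (hJ : J ∈ imSphere) (a b : ℝ)
    {s t : ℝ} (hs : 0 ≤ s) (ht : 0 ≤ t) :
    min s t * ‖I - J‖ ≤ ‖((a : ℍ[ℝ]) + s • I) - ((b : ℍ[ℝ]) + t • J)‖ := by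
  have hm : 0 ≤ min s t := le_min hs ht
  rw [← sq_le_sq₀ (by positivity) (norm_nonneg _), mul_pow]
  have h1 : min s t ^ 2 ≤ s * t := by
    rw [sq]; exact mul_le_mul (min_le_left _ _) (min_le_right _ _) hm hs
  have h2 : ‖((a : ℍ[ℝ]) + s • I) - ((b : ℍ[ℝ]) + t • J)‖ ^ 2 =
      (a - b) ^ 2 + (s - t) ^ 2 + s * t * ‖I - J‖ ^ 2 := by
    have hI1 := sum_sq_of_mem_imSphere hI
    have hJ1 := sum_sq_of_mem_imSphere hJ
    simp only [quaternion_norm_sq]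
    simp [hI.1, hJ.1]
    linear_combination (s ^ 2 - s * t) * hI1 + (t ^ 2 - s * t) * hJ1
  rw [h2]
  nlinarith [mul_le_mul_of_nonneg_right h1 (sq_nonneg ‖I - J‖), sq_nonneg (a - b), sq_nonneg (s - t)]

theorem min_mul_distSphere_le {I₁ I₂ : ℍ[ℝ]} (hI₁ : I₁ ∈ imSphere) (hI₂ : I₂ ∈ imSphere)
    (x₁ x₂ : ℝ) {y₁ y₂ : ℝ} (hy₁ : 0 ≤ y₁) (hy₂ : 0 ≤ y₂) {q₁ q₂ : ℍ[ℝ]}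
    (hq₁ : q₁ = (x₁ : ℍ[ℝ]) + y₁ • I₁) (hq₂ : q₂ = (x₂ : ℍ[ℝ]) + y₂ • I₂) :
    ENNReal.ofReal (min (y₁ / ‖q₁‖) (y₂ / ‖q₂‖)) * distSphere I₁ I₂ ≤
      ENNReal.ofReal Real.pi * distH q₁ q₂ := by
  have hnz : ∀ (x y : ℝ) (I q : ℍ[ℝ]), q = (x : ℍ[ℝ]) + y • I →
      ‖q‖⁻¹ • q = ((x / ‖q‖ : ℝ) : ℍ[ℝ]) + (y / ‖q‖) • I := fun x y I q h => by
    conv_lhs => rw [h, smul_add, smul_smul, ← h, ← Quaternion.coe_mul_eq_smul,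
      ← Quaternion.coe_mul]
    rw [div_eq_inv_mul, div_eq_inv_mul]
  have h1 := normalize_sub_le_distH q₁ q₂
  rw [hnz x₁ y₁ I₁ q₁ hq₁, hnz x₂ y₂ I₂ q₂ hq₂] at h1
  have h2 := min_mul_norm_sub_le hI₁ hI₂ (x₁ / ‖q₁‖) (x₂ / ‖q₂‖)
    (s := y₁ / ‖q₁‖) (t := y₂ / ‖q₂‖) (by positivity) (by positivity)
  set m := min (y₁ / ‖q₁‖) (y₂ / ‖q₂‖) with hm
  have hm0 : 0 ≤ m := le_min (by positivity) (by positivity)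
  calc ENNReal.ofReal m * distSphere I₁ I₂
      ≤ ENNReal.ofReal m * ENNReal.ofReal (Real.pi / 2 * ‖I₁ - I₂‖) := by
        gcongr; exact distSphere_le hI₁ hI₂
    _ = ENNReal.ofReal (Real.pi / 2) * ENNReal.ofReal (m * ‖I₁ - I₂‖) := by
        rw [← ENNReal.ofReal_mul hm0, ← ENNReal.ofReal_mul (by positivity)]
        congr 1; ring
    _ ≤ ENNReal.ofReal (Real.pi / 2) * (ENNReal.ofReal 2 * distH q₁ q₂) := by
        gcongr
        exact (ENNReal.ofReal_le_ofReal h2).trans h1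
    _ = ENNReal.ofReal Real.pi * distH q₁ q₂ := by
        rw [← mul_assoc, ← ENNReal.ofReal_mul (by positivity)]
        congr 2; ring

/-- Along the straight segment the real part stays above min(x₁, x₂). This crude bound gives
finiteness, and smallness of short vertical moves. -/
theorem distHyp_le_segment {I : ℍ[ℝ]} (hI : I ∈ imSphere) {x₁ x₂ : ℝ} (hx₁ : 0 < x₁) (hx₂ : 0 < x₂)
    (y₁ y₂ : ℝ) :
    distHyp I ((x₁ : ℍ[ℝ]) + y₁ • I) ((x₂ : ℍ[ℝ]) + y₂ • I) ≤
      ENNReal.ofReal (‖((x₂ - x₁ : ℝ) : ℍ[ℝ]) + (y₂ - y₁) • I‖ / (2 * min x₁ x₂)) := by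
  set d : ℍ[ℝ] := ((x₂ - x₁ : ℝ) : ℍ[ℝ]) + (y₂ - y₁) • I with hd
  set p : ℍ[ℝ] := (x₁ : ℍ[ℝ]) + y₁ • I with hp
  have hm : 0 < min x₁ x₂ := lt_min hx₁ hx₂
  have hre : ∀ t : ℝ, (p + t • d).re = x₁ + t * (x₂ - x₁) := fun t => by
    simp [hp, hd, hI.1]
  have hmin : ∀ t ∈ Icc (0 : ℝ) 1, min x₁ x₂ ≤ (p + t • d).re := fun t ht => by
    rw [hre]
    nlinarith [min_le_left x₁ x₂, min_le_right x₁ x₂, ht.1, ht.2]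
  have hmain := riemEDist_le_ofReal (U := halfSpace ∩ slice I)
    (Q := fun u v => ‖v‖ ^ 2 / (4 * u.re ^ 2)) (γ := fun t => p + t • d) (γ' := fun _ => d)
    (M := ‖d‖ / (2 * min x₁ x₂)) (ContDiff.contDiffOn (by fun_prop))
    (fun t ht => ⟨hm.trans_le (hmin t ht), Submodule.add_mem _ (coe_add_smul_mem_slice _ _ _)
      (Submodule.smul_mem _ _ (coe_add_smul_mem_slice _ _ _))⟩)
    (fun t _ => by
      simpa using (((hasDerivAt_id t).smul_const d).const_add p).hasDerivWithinAt)
    (fun t ht => by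
      have := hmin t ht
      rw [show 4 * (p + t • d).re ^ 2 = (2 * (p + t • d).re) ^ 2 by ring, ← div_pow,
        Real.sqrt_sq (div_nonneg (norm_nonneg _) (by linarith))]
      gcongr)
  have h0 : p + (0 : ℝ) • d = p := by simp
  have h1 : p + (1 : ℝ) • d = (x₂ : ℍ[ℝ]) + y₂ • I := by
    rw [hp, hd, one_smul, Quaternion.coe_sub, sub_smul]; abel
  simp only [h0, h1] at hmain
  exact hmain

theorem distHyp_triangle (I p q r : ℍ[ℝ]) : distHyp I p r ≤ distHyp I p q + distHyp I q r :=
  riemEDist_triangle (fun u c v => by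
    rw [norm_smul, mul_pow, Real.norm_eq_abs, sq_abs, mul_div_assoc]) p q r

theorem distH_triangle (p q r : ℍ[ℝ]) : distH p r ≤ distH p q + distH q r :=
  riemEDist_triangle hTensor_smul p q r

end Comparison

/-! ### The projection onto a slice does not increase distances -/

section Projection

theorem norm_sq_eq_re_sq_add_norm_im_sq (q : ℍ[ℝ]) : ‖q‖ ^ 2 = q.re ^ 2 + ‖q.im‖ ^ 2 := by
  simp only [quaternion_norm_sq]; simp; ring

theorem inner_eq_re_mul_re_add (p v : ℍ[ℝ]) :
    inner ℝ p v = p.re * v.re + ‖p.im‖ * inner ℝ v (imUnit p) := by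
  conv_lhs => rw [← coe_re_add_norm_im_smul_imUnit p, real_inner_comm, inner_coe_add_smul]
  ring

/-- A smooth approximation `x + y I ↦ x + √(y² + ε²) I₀` of the projection onto a slice. -/
noncomputable def smoothProj (I₀ : ℍ[ℝ]) (ε : ℝ) (q : ℍ[ℝ]) : ℍ[ℝ] :=
  (q.re : ℍ[ℝ]) + √(‖q.im‖ ^ 2 + ε ^ 2) • I₀

/-- Replacing |Im q|² by |q|² - (Re q)² leaves only smooth functions, with a positive radicand when
ε > 0. -/
theorem smoothProj_eq (I₀ : ℍ[ℝ]) (ε : ℝ) : smoothProj I₀ ε = fun q =>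
    innerSL ℝ (1 : ℍ[ℝ]) q • (1 : ℍ[ℝ]) +
      √(‖q‖ ^ 2 - (innerSL ℝ (1 : ℍ[ℝ]) q) ^ 2 + ε ^ 2) • I₀ := by
  funext q
  rw [smoothProj, innerSL_apply_apply, quaternion_inner_one_left, norm_sq_eq_re_sq_add_norm_im_sq q,
    ← Quaternion.coe_mul_eq_smul q.re, mul_one, add_sub_cancel_left]

theorem norm_sq_sub_re_sq_add_pos {ε : ℝ} (hε : 0 < ε) (q : ℍ[ℝ]) :
    0 < ‖q‖ ^ 2 - (innerSL ℝ (1 : ℍ[ℝ]) q) ^ 2 + ε ^ 2 := by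
  rw [innerSL_apply_apply, quaternion_inner_one_left, norm_sq_eq_re_sq_add_norm_im_sq]
  have : 0 < ε ^ 2 := by positivity
  nlinarith [sq_nonneg ‖q.im‖]

theorem contDiff_smoothProj (I₀ : ℍ[ℝ]) {ε : ℝ} (hε : 0 < ε) :
    ContDiff ℝ 1 (smoothProj I₀ ε) := by
  rw [smoothProj_eq]
  have h1 : ContDiff ℝ 1 (fun q : ℍ[ℝ] => innerSL ℝ (1 : ℍ[ℝ]) q) := (innerSL ℝ 1).contDiff
  exact (h1.smul contDiff_const).add
    (ContDiff.smul ((((contDiff_norm_sq ℝ).sub (h1.pow 2)).add contDiff_const).sqrt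
      fun q => (norm_sq_sub_re_sq_add_pos hε q).ne') contDiff_const)

theorem fderiv_smoothProj (I₀ : ℍ[ℝ]) {ε : ℝ} (hε : 0 < ε) (p v : ℍ[ℝ]) :
    fderiv ℝ (smoothProj I₀ ε) p v =
      (v.re : ℍ[ℝ]) + (‖p.im‖ * inner ℝ v (imUnit p) / √(‖p.im‖ ^ 2 + ε ^ 2)) • I₀ := by
  have h1 : HasFDerivAt (fun q : ℍ[ℝ] => innerSL ℝ (1 : ℍ[ℝ]) q) (innerSL ℝ 1) p :=
    (innerSL ℝ (1 : ℍ[ℝ])).hasFDerivAt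
  have h2 := (h1.smul_const (1 : ℍ[ℝ])).add
    (((((hasStrictFDerivAt_norm_sq p).hasFDerivAt.sub (h1.pow 2)).add_const (ε ^ 2)).sqrt
      (norm_sq_sub_re_sq_add_pos hε p).ne').smul_const I₀)
  rw [smoothProj_eq]
  refine (congrArg (fun f => f v) h2.fderiv).trans ?_
  simp [innerSL_apply_apply, quaternion_inner_one_left]
  rw [← Quaternion.coe_mul_eq_smul v.re, mul_one, norm_sq_eq_re_sq_add_norm_im_sq p,
    add_sub_cancel_left, inner_eq_re_mul_re_add p v]
  congr 2
  ring

/-- The real part is unchanged, and the vertical speed is multiplied by y/√(y² + ε²) ≤ 1. -/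
theorem distHyp_smoothProj_le {I₀ : ℍ[ℝ]} (hI₀ : I₀ ∈ imSphere) {ε : ℝ} (hε : 0 < ε)
    (p q : ℍ[ℝ]) :
    distHyp I₀ (smoothProj I₀ ε p) (smoothProj I₀ ε q) ≤ distH p q := by
  have hre : ∀ p, (smoothProj I₀ ε p).re = p.re := fun p => re_coe_add_smul hI₀ _ _
  have := riemEDist_map_le (U := halfSpace) (V := halfSpace ∩ slice I₀) (Q := hTensor)
    (R := fun u v => ‖v‖ ^ 2 / (4 * u.re ^ 2)) (f := smoothProj I₀ ε) one_pos
    (fun u _ => (contDiff_smoothProj I₀ hε).contDiffAt)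
    (fun u hu => ⟨coe_add_smul_mem_halfSpace hI₀ hu _, coe_add_smul_mem_slice _ _ _⟩)
    (fun γ _ hU t ht => by
      rw [one_mul]
      refine Real.sqrt_le_sqrt (le_trans ?_ (starProjection_le_hTensor (hU ht) _))
      rw [hre, fderiv_smoothProj I₀ hε, norm_sq_coe_add_smul hI₀]
      gcongr ?_ / _
      have hpos : 0 < ‖(γ t).im‖ ^ 2 + ε ^ 2 := by positivity
      rw [div_pow, Real.sq_sqrt hpos.le, mul_pow]
      refine add_le_add_right ((div_le_iff₀ hpos).mpr ?_) _
      nlinarith [sq_nonneg (inner ℝ (derivWithin γ (Icc 0 1) t) (imUnit (γ t)) * ε)]) p q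
  rwa [ENNReal.ofReal_one, one_mul] at this

theorem distHyp_vertical_le {I : ℍ[ℝ]} (hI : I ∈ imSphere) {x : ℝ} (hx : 0 < x) (y₁ y₂ : ℝ) :
    distHyp I ((x : ℍ[ℝ]) + y₁ • I) ((x : ℍ[ℝ]) + y₂ • I) ≤
      ENNReal.ofReal (|y₂ - y₁| / (2 * x)) := by
  refine (distHyp_le_segment hI hx hx y₁ y₂).trans_eq ?_
  rw [sub_self, Quaternion.coe_zero, zero_add, norm_smul, hI.2, mul_one, min_self, Real.norm_eq_abs]

theorem abs_sqrt_sq_add_sq_sub_le {m ε : ℝ} (hm : 0 ≤ m) (hε : 0 ≤ ε) :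
    |√(m ^ 2 + ε ^ 2) - m| ≤ ε := by
  have h1 : m ≤ √(m ^ 2 + ε ^ 2) := Real.le_sqrt_of_sq_le (by nlinarith)
  have h2 : √(m ^ 2 + ε ^ 2) ≤ m + ε := Real.sqrt_le_iff.mpr ⟨by positivity, by nlinarith⟩
  rw [abs_of_nonneg (by linarith)]
  linarith

theorem distHyp_sliceProj_le {I₀ : ℍ[ℝ]} (hI₀ : I₀ ∈ imSphere) {p q : ℍ[ℝ]} (hp : p ∈ halfSpace)
    (hq : q ∈ halfSpace) : distHyp I₀ (sliceProj I₀ p) (sliceProj I₀ q) ≤ distH p q := by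
  have hp0 : 0 < p.re := hp
  have hq0 : 0 < q.re := hq
  refine ENNReal.le_of_forall_pos_le_add fun δ hδ _ => ?_
  have hδ' : (0 : ℝ) < δ := hδ
  set A : ℝ := 1 / (2 * p.re) + 1 / (2 * q.re) with hA
  have hA0 : 0 < A := by positivity
  -- Smoothing displaces each endpoint vertically by at most ε, at total cost at most εA = δ.
  set ε : ℝ := δ / A with hεdef
  have hε : 0 < ε := by positivity
  have h1 : distHyp I₀ (sliceProj I₀ p) (smoothProj I₀ ε p) ≤ ENNReal.ofReal (ε / (2 * p.re)) := by
    refine (distHyp_vertical_le hI₀ hp0 _ _).trans (ENNReal.ofReal_le_ofReal ?_)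
    gcongr
    exact abs_sqrt_sq_add_sq_sub_le (norm_nonneg _) hε.le
  have h2 : distHyp I₀ (smoothProj I₀ ε q) (sliceProj I₀ q) ≤ ENNReal.ofReal (ε / (2 * q.re)) := by
    refine (distHyp_vertical_le hI₀ hq0 _ _).trans (ENNReal.ofReal_le_ofReal ?_)
    gcongr
    rw [abs_sub_comm]
    exact abs_sqrt_sq_add_sq_sub_le (norm_nonneg _) hε.le
  calc distHyp I₀ (sliceProj I₀ p) (sliceProj I₀ q)
      ≤ distHyp I₀ (sliceProj I₀ p) (smoothProj I₀ ε p) +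
        (distHyp I₀ (smoothProj I₀ ε p) (smoothProj I₀ ε q) +
          distHyp I₀ (smoothProj I₀ ε q) (sliceProj I₀ q)) :=
        (distHyp_triangle _ _ _ _).trans (by gcongr; exact distHyp_triangle _ _ _ _)
    _ ≤ ENNReal.ofReal (ε / (2 * p.re)) + (distH p q + ENNReal.ofReal (ε / (2 * q.re))) := by
        gcongr
        exact distHyp_smoothProj_le hI₀ hε p q
    _ = distH p q + (ENNReal.ofReal (ε / (2 * p.re)) + ENNReal.ofReal (ε / (2 * q.re))) := by ring
    _ = distH p q + δ := by
        rw [← ENNReal.ofReal_add (by positivity) (by positivity),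
          show ε / (2 * p.re) + ε / (2 * q.re) = ε * A by rw [hA]; ring, hεdef,
          div_mul_cancel₀ _ hA0.ne', ENNReal.ofReal_coe_nnreal]

end Projection

/-! ### Assembling the two-sided estimate -/

theorem sliceProj_coe_add_smul (I₀ : ℍ[ℝ]) {I : ℍ[ℝ]} (hI : I ∈ imSphere) (x : ℝ) {y : ℝ}
    (hy : 0 ≤ y) : sliceProj I₀ ((x : ℍ[ℝ]) + y • I) = (x : ℍ[ℝ]) + y • I₀ := by
  rw [sliceProj, re_coe_add_smul hI, im_coe_add_smul hI, norm_smul, hI.2, mul_one,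
    Real.norm_of_nonneg hy]

/-- The intermediate point is x₁ + y₁I₂ or x₂ + y₂I₁, according to which endpoint attains the
minimum, so that the rotation happens there. -/
theorem distH_le {I₀ I₁ I₂ : ℍ[ℝ]} (hI₀ : I₀ ∈ imSphere) (hI₁ : I₁ ∈ imSphere)
    (hI₂ : I₂ ∈ imSphere) {x₁ y₁ x₂ y₂ : ℝ} (hx₁ : 0 < x₁) (hy₁ : 0 ≤ y₁) (hx₂ : 0 < x₂)
    (hy₂ : 0 ≤ y₂) :
    distH ((x₁ : ℍ[ℝ]) + y₁ • I₁) ((x₂ : ℍ[ℝ]) + y₂ • I₂) ≤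
      distHyp I₀ ((x₁ : ℍ[ℝ]) + y₁ • I₀) ((x₂ : ℍ[ℝ]) + y₂ • I₀) +
        ENNReal.ofReal (min (y₁ / √(x₁ ^ 2 + y₁ ^ 2)) (y₂ / √(x₂ ^ 2 + y₂ ^ 2))) *
          distSphere I₁ I₂ := by
  rcases min_choice (y₁ / √(x₁ ^ 2 + y₁ ^ 2)) (y₂ / √(x₂ ^ 2 + y₂ ^ 2)) with h | h
  · rw [h]
    exact (distH_triangle _ ((x₁ : ℍ[ℝ]) + y₁ • I₂) _).trans
      ((add_le_add (distH_le_distSphere I₁ I₂ hx₁ hy₁)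
        (distH_le_distHyp hI₀ hI₂ _ _ _ _)).trans_eq (add_comm _ _))
  · rw [h]
    exact (distH_triangle _ ((x₂ : ℍ[ℝ]) + y₂ • I₁) _).trans
      (add_le_add (distH_le_distHyp hI₀ hI₁ _ _ _ _) (distH_le_distSphere I₁ I₂ hx₂ hy₂))

end SliceMetric

theorem mainTheorem4 :
    ∃ C₁ C₂ : ℝ, 0 < C₁ ∧ 0 < C₂ ∧
      ∀ I₀ ∈ SliceMetric.imSphere,
      ∀ I₁ ∈ SliceMetric.imSphere, ∀ I₂ ∈ SliceMetric.imSphere,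
      ∀ x₁ y₁ x₂ y₂ : ℝ, 0 < x₁ → 0 ≤ y₁ → 0 < x₂ → 0 ≤ y₂ →
      ∀ q₁ q₂ : ℍ[ℝ], q₁ = (x₁ : ℍ[ℝ]) + y₁ • I₁ → q₂ = (x₂ : ℍ[ℝ]) + y₂ • I₂ →
        SliceMetric.distH q₁ q₂ ≠ ⊤ ∧
        ENNReal.ofReal C₁ * SliceMetric.distH q₁ q₂ ≤
          SliceMetric.distHyp I₀ (SliceMetric.sliceProj I₀ q₁) (SliceMetric.sliceProj I₀ q₂)
            + ENNReal.ofReal (min (y₁ / ‖q₁‖) (y₂ / ‖q₂‖)) * SliceMetric.distSphere I₁ I₂ ∧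
        SliceMetric.distHyp I₀ (SliceMetric.sliceProj I₀ q₁) (SliceMetric.sliceProj I₀ q₂)
            + ENNReal.ofReal (min (y₁ / ‖q₁‖) (y₂ / ‖q₂‖)) * SliceMetric.distSphere I₁ I₂ ≤
          ENNReal.ofReal C₂ * SliceMetric.distH q₁ q₂ := by
  -- In C₂ = 1 + π, the 1 pays for the hyperbolic term and π = 2·(π/2) for the spherical one: 2 from
  -- the radial projection, π/2 from arc against chord.
  refine ⟨1, 1 + Real.pi, one_pos, by positivity, ?_⟩
  intro I₀ hI₀ I₁ hI₁ I₂ hI₂ x₁ y₁ x₂ y₂ hx₁ hy₁ hx₂ hy₂ q₁ q₂ hq₁ hq₂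
  have hle : SliceMetric.distH q₁ q₂ ≤
      SliceMetric.distHyp I₀ (SliceMetric.sliceProj I₀ q₁) (SliceMetric.sliceProj I₀ q₂)
        + ENNReal.ofReal (min (y₁ / ‖q₁‖) (y₂ / ‖q₂‖)) * SliceMetric.distSphere I₁ I₂ := by
    rw [hq₁, hq₂, SliceMetric.sliceProj_coe_add_smul I₀ hI₁ x₁ hy₁,
      SliceMetric.sliceProj_coe_add_smul I₀ hI₂ x₂ hy₂, SliceMetric.norm_coe_add_smul hI₁,
      SliceMetric.norm_coe_add_smul hI₂]
    exact SliceMetric.distH_le hI₀ hI₁ hI₂ hx₁ hy₁ hx₂ hy₂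
  refine ⟨ne_top_of_le_ne_top (ENNReal.add_ne_top.mpr ⟨?_, ENNReal.mul_ne_top
    ENNReal.ofReal_ne_top ?_⟩) hle, by rwa [ENNReal.ofReal_one, one_mul], ?_⟩
  · rw [hq₁, hq₂, SliceMetric.sliceProj_coe_add_smul I₀ hI₁ x₁ hy₁,
      SliceMetric.sliceProj_coe_add_smul I₀ hI₂ x₂ hy₂]
    exact ne_top_of_le_ne_top ENNReal.ofReal_ne_top
      (SliceMetric.distHyp_le_segment hI₀ hx₁ hx₂ y₁ y₂)
  · exact ne_top_of_le_ne_top ENNReal.ofReal_ne_top (SliceMetric.distSphere_le hI₁ hI₂)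
  · rw [ENNReal.ofReal_add zero_le_one Real.pi_pos.le, ENNReal.ofReal_one, add_mul, one_mul]
    refine add_le_add (SliceMetric.distHyp_sliceProj_le hI₀ ?_ ?_)
      (SliceMetric.min_mul_distSphere_le hI₁ hI₂ x₁ x₂ hy₁ hy₂ hq₁ hq₂)
    · rw [hq₁]; exact SliceMetric.coe_add_smul_mem_halfSpace hI₁ hx₁ y₁
    · rw [hq₂]; exact SliceMetric.coe_add_smul_mem_halfSpace hI₂ hx₂ y₂
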